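/- There is a universal constant $C>0$ such that the following holds. Consider a time-homogeneous hidden Markov model with finite hidden state space $\mathcal H$ and finite observation space $\mathcal O$, given by an initial distribution of $h_1$ on $\mathcal H$, a transition $\mathbb P(h'\mid h)$ and an emission $\mathbb T(o\mid h)$. For $b\in\Delta(\mathcal H)$ write $\mathbb T b=\sum_{h}\mathbb T(\cdot\mid h)\,b(h)\in\Delta(\mathcal O)$. Suppose that (i) (low rank) $\mathbb P(h'\mid h)=w(h')^\top\psi(h)$ for all $h,h'\in\mathcal H$, where $w,\psi:\mathcal H\to\mathbb R^d$; (ii) (over-complete $\gamma$-observability) $\gamma>0$ and $\|\mathbb T b-\mathbb T b'\|_1\ge\gamma\,\|b-b'\|_1$ for all $b,b'\in\Delta(\mathcal H)$. Then for every $\varepsilon>0$ and every integer $L\ge 1$ with $L\ge C\gamma^{-4}\log(d/\varepsilon)$ (so, for $\varepsilon<d$, one may take $L=\lceil C\gamma^{-4}\log(d/\varepsilon)\rceil$, that is, $L=\Theta(\gamma^{-4}\log(d/\varepsilon))$ up to rounding) there is an $(L-1)$-memory transition probability $\mathbb P_L(\cdot\mid z)\in\Delta(\mathcal O)$, $z\in\mathcal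 O^{L-1}$, of the form $$\mathbb P_L(o_k\mid o_{k-L+1:k-1})=\mu(o_k)^\top\phi(o_{k-L+1:k-1}),\qquad \mu(o)=\sum_{h\in\mathcal H}\mathbb T(o\mid h)\,w(h)\in\mathbb R^d,\quad \phi:\mathcal O^{L-1}\to\mathbb R^d,$$ such that for all $k\ge L+1$ $$\mathbb E_{o_{1:k-1}}\big\|\mathbb P(\cdot\mid o_{1:k-1})-\mathbb P_L(\cdot\mid o_{k-L+1:k-1})\big\|_1\le\varepsilon ,$$ where the expectation is over the first $k-1$ observations of the model and $\mathbb P(\cdot\mid o_{1:k-1})$ is the conditional law of $o_k$ given $o_{1:k-1}$. The same $\mathbb P_L$ serves all $k\ge L+1$. -/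

import Mathlib

universe u v

/-- A (time-homogeneous) hidden Markov model with finite hidden state space `H` and finite
observation space `O`: `init h = P(h₁ = h)`, `trans h h' = P(h' | h)`, `emit h x = 𝕋(x | h)`. -/
structure HMM (H : Type u) (O : Type v) [Fintype H] [Fintype O] where
  init : H → ℝ
  trans : H → H → ℝ
  emit : H → O → ℝ
  init_mem : init ∈ stdSimplex ℝ H
  trans_mem : ∀ h, trans h ∈ stdSimplex ℝ H
  emit_mem : ∀ h, emit h ∈ stdSimplex ℝ O

namespace HMM

variable {H : Type u} {O : Type v} [Fintype H] [Fintype O]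

/-- The probability that the first `n + 1` hidden states are `h` and the first `n + 1`
observations are `o`. -/
def jointProb (M : HMM H O) {n : ℕ} (h : Fin (n + 1) → H) (o : Fin (n + 1) → O) : ℝ :=
  M.init (h 0) * (∏ i : Fin n, M.trans (h i.castSucc) (h i.succ)) * ∏ i, M.emit (h i) (o i)

/-- The probability that the first `m` observations are `o`. -/
def obsProb (M : HMM H O) : {m : ℕ} → (Fin m → O) → ℝ
  | 0, _ => 1
  | n + 1, o => ∑ h : Fin (n + 1) → H, M.jointProb h o

/-- The conditional probability that the next observation is `x`, given that the first `m`
observations are `o`. It has the value `0` for histories `o` of probability `0`. -/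
noncomputable def condProb (M : HMM H O) {m : ℕ} (o : Fin m → O) (x : O) : ℝ :=
  M.obsProb (Fin.snoc o x : Fin (m + 1) → O) / M.obsProb o

/-- The emission operator `𝕋 b = ∑ h, 𝕋(· | h) b(h)`. -/
def emitOp (M : HMM H O) (b : H → ℝ) (x : O) : ℝ := ∑ h, M.emit h x * b h

/-- The hidden state transition factorizes through `ℝ^d`: `P(h' | h) = w(h')ᵀ ψ(h)`. -/
def IsLowRank (M : HMM H O) {d : ℕ} (w ψ : H → Fin d → ℝ) : Prop :=
  ∀ h h', M.trans h h' = w h' ⬝ᵥ ψ h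

/-- Over-complete `γ`-observability: `‖𝕋 b - 𝕋 b'‖₁ ≥ γ ‖b - b'‖₁` for all distributions. -/
def IsObservable (M : HMM H O) (γ : ℝ) : Prop :=
  ∀ b ∈ stdSimplex ℝ H, ∀ b' ∈ stdSimplex ℝ H,
    γ * ∑ h, |b h - b' h| ≤ ∑ x, |M.emitOp b x - M.emitOp b' x|

/-- The representation `μ(x) = ∑ h, 𝕋(x | h) w(h)` of the next observation. -/
def obsFeature (M : HMM H O) {d : ℕ} (w : H → Fin d → ℝ) (x : O) : Fin d → ℝ :=
  ∑ h, M.emit h x • w h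

end HMM

/-- The last `L - 1` entries `o_{k-L+1}, …, o_{k-1}` of a history `o_1, …, o_{k-1}`; the entry
`o_j` is `o ⟨j - 1, _⟩`. -/
def recentObs {O : Type v} {L k : ℕ} (hk : L < k) (o : Fin (k - 1) → O) : Fin (L - 1) → O :=
  fun i => o ⟨k - L + i, by omega⟩

namespace HMM

variable {H : Type u} {O : Type v} [Fintype H] [Fintype O]

/-- `𝔼_{o_{1:k-1}} ‖P(· | o_{1:k-1}) - Q(· | o_{k-L+1:k-1})‖₁` for an `(L-1)`-memory
transition `Q`. -/
noncomputable def expectedError (M : HMM H O) {L k : ℕ} (hk : L < k)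
    (Q : (Fin (L - 1) → O) → O → ℝ) : ℝ :=
  ∑ o : Fin (k - 1) → O, M.obsProb o * ∑ x, |M.condProb o x - Q (recentObs hk o) x|

end HMM

/-! Low rank yields a law `b` with `trans h h' ≤ d * b h'` for all states
(`IsLowRank.exists_dominating`). The predictor runs the Bayes filter from `b` on the last `L - 1`
observations. The true filter is the same recursion started from the law given the older
observations; that law has passed a transition, so its density with respect to `b` is at most `d`
and its `χ²`-divergence from `b` at most `d - 1`. The filter forgets this discrepancy. For `γ ≤ 1`,
an observation multiplies the expected `χ` (the root of `χ²`) by at most `1 - γ ^ 2 / 32`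
(`sum_chiMass_condObs_le`), and a transition never increases it (`chiMass_pushTrans_le`). As `χ`
bounds the `L¹` distance, the error is at most `(1 - γ ^ 2 / 32) ^ (L - 1) * √(d - 1)`. Keeping
measures unnormalized in `chiMass` turns expectations into plain sums over observations. Since `b`
is itself the image of a law under the transition, every state of the predictor is linear in `w`,
which gives the form of `P_L`. -/

section Analysis

/-! ### `χ`-divergence and Cauchy–Schwarz inequalities. -/

variable {ι : Type*} [Fintype ι]

/-- A multiple of `χ(p ‖ q)`: for measures `p`, `q` of masses `P`, `Q`, it is `P` times the square
root of the `χ²`-divergence between the normalizations of `p` and `q`. -/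
noncomputable def chiMass (p q : ι → ℝ) : ℝ :=
  √((∑ i, q i) * (∑ i, p i ^ 2 / q i) - (∑ i, p i) ^ 2)

lemma chiMass_nonneg (p q : ι → ℝ) : 0 ≤ chiMass p q := Real.sqrt_nonneg _

lemma sq_sum_abs_le (D q : ι → ℝ) (hq : ∀ i, 0 ≤ q i) (hD : ∀ i, q i = 0 → D i = 0) :
    (∑ i, |D i|) ^ 2 ≤ (∑ i, q i) * ∑ i, D i ^ 2 / q i := by
  refine Finset.sum_sq_le_sum_mul_sum_of_sq_le_mul _ (fun i _ => hq i)
    (fun i _ => div_nonneg (sq_nonneg _) (hq i)) fun i _ => ?_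
  rw [sq_abs]
  by_cases h : q i = 0
  · simp [h, hD i h]
  · rw [mul_div_cancel₀ _ h]

lemma sum_sub_smul_sq_div (p q : ι → ℝ) (hp : ∀ i, q i = 0 → p i = 0) (t : ℝ) :
    ∑ i, (p i - t * q i) ^ 2 / q i
      = ∑ i, p i ^ 2 / q i - 2 * t * ∑ i, p i + t ^ 2 * ∑ i, q i := by
  rw [Finset.mul_sum, Finset.mul_sum, ← Finset.sum_sub_distrib, ← Finset.sum_add_distrib]
  refine Finset.sum_congr rfl fun i _ => ?_
  by_cases h : q i = 0
  · simp [h, hp i h]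
  · field_simp
    ring

/-- The quantity under the root in `chiMass` does not change when a multiple of `q` is subtracted
from `p`. -/
lemma chiMass_sub_smul (p q : ι → ℝ) (hp : ∀ i, q i = 0 → p i = 0) (t : ℝ) :
    chiMass (fun i => p i - t * q i) q = chiMass p q := by
  unfold chiMass
  rw [sum_sub_smul_sq_div p q hp t, Finset.sum_sub_distrib, ← Finset.mul_sum]
  congr 1
  ring

/-- Cauchy–Schwarz after centring: the subtracted multiple of `q` has the mass of `p`, so the
squared mean in `chiMass` vanishes. -/
lemma sum_abs_le_chiMass (p q : ι → ℝ) (hq : ∀ i, 0 ≤ q i) (hp : ∀ i, q i = 0 → p i = 0) :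
    ∑ i, |p i - (∑ j, p j) / (∑ j, q j) * q i| ≤ chiMass p q := by
  rw [← chiMass_sub_smul p q hp ((∑ j, p j) / (∑ j, q j))]
  have h0 : ∑ i, (p i - (∑ j, p j) / (∑ j, q j) * q i) = 0 := by
    rw [Finset.sum_sub_distrib, ← Finset.mul_sum]
    by_cases h : ∑ j, q j = 0
    · have : ∀ i, q i = 0 := fun i =>
        (Finset.sum_eq_zero_iff_of_nonneg fun i _ => hq i).1 h i (Finset.mem_univ i)
      simp [this, hp]
    · field_simp
      ring
  unfold chiMass
  rw [h0]
  refine Real.le_sqrt_of_sq_le ?_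
  have := sq_sum_abs_le (fun i => p i - (∑ j, p j) / (∑ j, q j) * q i) q hq
    (fun i hi => by simp [hi, hp i hi])
  linarith

/-- The Bhattacharyya coefficient of two probability vectors is bounded by their distance. -/
lemma sum_sqrt_mul_le_of_sum_eq_one (u v : ι → ℝ) (hu : ∀ i, 0 ≤ u i) (hv : ∀ i, 0 ≤ v i)
    (hu1 : ∑ i, u i = 1) (hv1 : ∑ i, v i = 1) :
    ∑ i, √(u i * v i) ≤ 1 - (∑ i, |u i - v i|) ^ 2 / 8 := by
  set B := ∑ i, √(u i * v i) with hB
  have hB0 : 0 ≤ B := Finset.sum_nonneg fun i _ => Real.sqrt_nonneg _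
  have hs : ∀ c : ℝ, ∑ i, (u i + v i + c * √(u i * v i)) = 2 + c * B := fun c => by
    rw [Finset.sum_add_distrib, Finset.sum_add_distrib, ← Finset.mul_sum, hu1, hv1]
    ring
  have e : ∀ i, ∃ a b, 0 ≤ a ∧ 0 ≤ b ∧ u i = a ^ 2 ∧ v i = b ^ 2 ∧ √(u i * v i) = a * b :=
    fun i => ⟨√(u i), √(v i), Real.sqrt_nonneg _, Real.sqrt_nonneg _, (Real.sq_sqrt (hu i)).symm,
      (Real.sq_sqrt (hv i)).symm, Real.sqrt_mul (hu i) _⟩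
  have h := Finset.sum_sq_le_sum_mul_sum_of_sq_le_mul Finset.univ (r := fun i => |u i - v i|)
    (f := fun i => u i + v i + (-2) * √(u i * v i)) (g := fun i => u i + v i + 2 * √(u i * v i))
    (fun i _ => by
      obtain ⟨a, b, ha, hb, h1, h2, h3⟩ := e i
      rw [h3, h1, h2]
      nlinarith [sq_nonneg (a - b)])
    (fun i _ => by
      have := Real.sqrt_nonneg (u i * v i)
      linarith [hu i, hv i])
    (fun i _ => by
      obtain ⟨a, b, ha, hb, h1, h2, h3⟩ := e i
      rw [sq_abs, h3, h1, h2]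
      exact le_of_eq (by ring))
  rw [hs, hs] at h
  -- `h` reads `δ² ≤ 4 (1 - B²)` with `δ` the `L¹` distance; then `2 B ≤ 1 + B²` gives the bound.
  nlinarith [sq_nonneg (B - 1)]

lemma sum_sqrt_mul_le (u v : ι → ℝ) (hu : ∀ i, 0 ≤ u i) (hv : ∀ i, 0 ≤ v i)
    (hU : 0 < ∑ i, u i) (hV : 0 < ∑ i, v i) :
    ∑ i, √(u i * v i) ≤ √((∑ i, u i) * ∑ i, v i) *
      (1 - (∑ i, |u i / (∑ j, u j) - v i / (∑ j, v j)|) ^ 2 / 8) := by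
  set U := ∑ i, u i
  set V := ∑ i, v i
  have h := sum_sqrt_mul_le_of_sum_eq_one (fun i => u i / U) (fun i => v i / V)
    (fun i => div_nonneg (hu i) hU.le) (fun i => div_nonneg (hv i) hV.le)
    (by rw [← Finset.sum_div, div_self hU.ne']) (by rw [← Finset.sum_div, div_self hV.ne'])
  refine le_trans (le_of_eq ?_) (mul_le_mul_of_nonneg_left h (Real.sqrt_nonneg _))
  rw [Finset.mul_sum]
  refine Finset.sum_congr rfl fun i _ => ?_
  rw [← Real.sqrt_mul (by positivity)]
  congr 1
  field_simp

/-- Split `v` into `D² / u` and the rest, apply Cauchy–Schwarz against `u` to each part, and add. -/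
lemma sq_sum_sqrt_add_sq_sum_abs_le (u v D : ι → ℝ) (hu : ∀ i, 0 ≤ u i) (hv : ∀ i, 0 ≤ v i)
    (hD : ∀ i, D i ^ 2 ≤ u i * v i) :
    (∑ i, √(u i * v i - D i ^ 2)) ^ 2 + (∑ i, |D i|) ^ 2 ≤ (∑ i, u i) * ∑ i, v i := by
  have hD0 : ∀ i, u i = 0 → D i = 0 := fun i hi => by
    have := hD i
    rw [hi, zero_mul] at this
    exact pow_eq_zero_iff two_ne_zero |>.1 (le_antisymm this (sq_nonneg _))
  have hw : ∀ i, 0 ≤ v i - D i ^ 2 / u i := fun i => by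
    rcases (hu i).eq_or_lt with h | h
    · simpa [← h] using hv i
    · rw [sub_nonneg, div_le_iff₀ h]
      linarith [hD i]
  have h1 := sq_sum_abs_le D u hu hD0
  have h2 := Finset.sum_sq_le_sum_mul_sum_of_sq_le_mul Finset.univ
    (r := fun i => √(u i * v i - D i ^ 2)) (f := u) (g := fun i => v i - D i ^ 2 / u i)
    (fun i _ => hu i) (fun i _ => hw i) (fun i _ => by
      rw [Real.sq_sqrt (sub_nonneg.2 (hD i))]
      by_cases h : u i = 0
      · simp [h, sq_nonneg]
      · rw [mul_sub, mul_div_cancel₀ _ h])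
  rw [Finset.sum_sub_distrib, mul_sub] at h2
  linarith

end Analysis

/-! ### Contraction of `χ` by one observation. -/

namespace HMM

variable {H : Type u} {O : Type v} [Fintype H] [Fintype O]

lemma emit_nonneg (M : HMM H O) (h : H) (x : O) : 0 ≤ M.emit h x := (M.emit_mem h).1 x

lemma trans_nonneg (M : HMM H O) (h h' : H) : 0 ≤ M.trans h h' := (M.trans_mem h).1 h'

lemma emitOp_nonneg (M : HMM H O) {b : H → ℝ} (hb : ∀ h, 0 ≤ b h) (x : O) : 0 ≤ M.emitOp b x :=
  Finset.sum_nonneg fun h _ => mul_nonneg (M.emit_nonneg h x) (hb h)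

lemma sum_emitOp (M : HMM H O) (b : H → ℝ) : ∑ x, M.emitOp b x = ∑ h, b h := by
  unfold emitOp
  rw [Finset.sum_comm]
  refine Finset.sum_congr rfl fun h _ => ?_
  rw [← Finset.sum_mul, (M.emit_mem h).2, one_mul]

lemma emitOp_sub (M : HMM H O) (a b : H → ℝ) (x : O) :
    M.emitOp (fun h => a h - b h) x = M.emitOp a x - M.emitOp b x := by
  simp only [emitOp, mul_sub, Finset.sum_sub_distrib]

lemma emitOp_div (M : HMM H O) (a : H → ℝ) (c : ℝ) (x : O) :
    M.emitOp (fun h => a h / c) x = M.emitOp a x / c := by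
  simp only [emitOp, Finset.sum_div, mul_div_assoc]

lemma sum_abs_emitOp_le (M : HMM H O) (b : H → ℝ) : ∑ x, |M.emitOp b x| ≤ ∑ h, |b h| := by
  rw [← M.sum_emitOp fun h => |b h|]
  refine Finset.sum_le_sum fun x _ => (Finset.abs_sum_le_sum_abs _ _).trans (le_of_eq ?_)
  refine Finset.sum_congr rfl fun h _ => ?_
  rw [abs_mul, abs_of_nonneg (M.emit_nonneg h x)]

lemma IsObservable.of_nonneg {M : HMM H O} {γ : ℝ} (hM : M.IsObservable γ) {a b : H → ℝ}
    (ha : ∀ h, 0 ≤ a h) (hb : ∀ h, 0 ≤ b h) (hab : ∑ h, a h = ∑ h, b h) :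
    γ * ∑ h, |a h - b h| ≤ ∑ x, |M.emitOp a x - M.emitOp b x| := by
  rcases (Finset.sum_nonneg fun h (_ : h ∈ Finset.univ) => ha h).eq_or_lt with h0 | h0
  · have ha0 : ∀ h, a h = 0 := fun h =>
      (Finset.sum_eq_zero_iff_of_nonneg fun i _ => ha i).1 h0.symm h (Finset.mem_univ h)
    have hb0 : ∀ h, b h = 0 := fun h =>
      (Finset.sum_eq_zero_iff_of_nonneg fun i _ => hb i).1 (hab ▸ h0.symm) h (Finset.mem_univ h)
    simp [emitOp, ha0, hb0]
  · set S := ∑ h, a h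
    have key := hM (fun h => a h / S)
      ⟨fun h => div_nonneg (ha h) h0.le, by rw [← Finset.sum_div, div_self h0.ne']⟩
      (fun h => b h / S)
      ⟨fun h => div_nonneg (hb h) h0.le, by rw [← Finset.sum_div, ← hab, div_self h0.ne']⟩
    simp only [emitOp_div, ← sub_div, abs_div, abs_of_pos h0, ← Finset.sum_div] at key
    rwa [← mul_div_assoc, div_le_div_iff_of_pos_right h0] at key

/-- Conditioning on an observation, before normalization. -/
def condObs (M : HMM H O) (x : O) (b : H → ℝ) (h : H) : ℝ := M.emit h x * b h

lemma sum_condObs (M : HMM H O) (x : O) (b : H → ℝ) : ∑ h, M.condObs x b h = M.emitOp b x := rfl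

lemma chiMass_condObs (M : HMM H O) (p q : H → ℝ) (hp : ∀ h, q h = 0 → p h = 0) (t : ℝ) (x : O) :
    chiMass (M.condObs x p) (M.condObs x q) =
      √(M.emitOp q x * M.emitOp (fun h => (p h - t * q h) ^ 2 / q h) x
        - M.emitOp (fun h => p h - t * q h) x ^ 2) := by
  rw [← chiMass_sub_smul _ _ _ t]
  · unfold chiMass
    rw [sum_condObs]
    congr 3
    · refine Finset.sum_congr rfl fun h _ => ?_
      unfold condObs
      by_cases he : M.emit h x = 0
      · simp [he]
      · by_cases hq : q h = 0
        · simp [hq]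
        · field_simp
    · refine Finset.sum_congr rfl fun h _ => ?_
      unfold condObs
      ring
  · intro h
    unfold condObs
    rw [mul_eq_zero, mul_eq_zero]
    exact Or.imp_right (hp h)

/-- With `D = p - t q` centred and `v = D² / q`, each summand is `√(𝕋q · 𝕋v - (𝕋D)²)`, while `χ`
beforehand is `S = √(Q V)`. Either `D` is large in `L¹` and observability keeps `𝕋D` large, or `q`
and `v` have different shapes and observability keeps `𝕋q` and `𝕋v` apart, a gain in Cauchy–Schwarz.
-/
lemma sum_chiMass_condObs_le (M : HMM H O) {γ : ℝ} (hγ : 0 < γ) (hγ1 : γ ≤ 1)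
    (hM : M.IsObservable γ) (p q : H → ℝ) (hp0 : ∀ h, 0 ≤ p h) (hq : ∀ h, 0 ≤ q h)
    (hp : ∀ h, q h = 0 → p h = 0) :
    ∑ x, chiMass (M.condObs x p) (M.condObs x q) ≤ (1 - γ ^ 2 / 32) * chiMass p q := by
  rcases (Finset.sum_nonneg fun h (_ : h ∈ Finset.univ) => hq h).eq_or_lt with h0 | hQ
  · have hq0 : ∀ h, q h = 0 := fun h =>
      (Finset.sum_eq_zero_iff_of_nonneg fun i _ => hq i).1 h0.symm h (Finset.mem_univ h)
    simp [chiMass, condObs, hq0, hp]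
  set Q := ∑ h, q h with hQdef
  set t := (∑ h, p h) / Q with ht
  have ht0 : 0 ≤ t := div_nonneg (Finset.sum_nonneg fun h _ => hp0 h) hQ.le
  rw [← chiMass_sub_smul p q hp t]
  simp only [M.chiMass_condObs p q hp t]
  set D : H → ℝ := fun h => p h - t * q h with hD
  set v : H → ℝ := fun h => D h ^ 2 / q h with hv
  have hDq : ∀ h, q h = 0 → D h = 0 := fun h hh => by simp [hD, hh, hp h hh]
  have hsum : ∑ h, p h = ∑ h, t * q h := by
    rw [← Finset.mul_sum, ht, div_mul_cancel₀ _ hQ.ne']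
  have hDsum : ∑ h, D h = 0 := by rw [Finset.sum_sub_distrib, ← hsum, sub_self]
  have hv0 : ∀ h, 0 ≤ v h := fun h => div_nonneg (sq_nonneg _) (hq h)
  have hvsum : 0 ≤ ∑ h, v h := Finset.sum_nonneg fun h _ => hv0 h
  have hchi : chiMass D q = √(Q * ∑ h, v h) := by
    unfold chiMass
    rw [hDsum]
    congr 1
    ring
  rw [hchi]
  rcases hvsum.eq_or_lt with hV | hV
  · have hvz : ∀ h, v h = 0 := fun h =>
      (Finset.sum_eq_zero_iff_of_nonneg fun i _ => hv0 i).1 hV.symm h (Finset.mem_univ h)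
    rw [← hV, mul_zero, Real.sqrt_zero, mul_zero]
    refine le_of_eq (Finset.sum_eq_zero fun x _ => Real.sqrt_eq_zero_of_nonpos ?_)
    have : M.emitOp v x = 0 := Finset.sum_eq_zero fun h _ => by rw [hvz, mul_zero]
    rw [this]
    nlinarith [sq_nonneg (M.emitOp D x)]
  set V := ∑ h, v h with hVdef
  set S := √(Q * V) with hS
  have hSpos : 0 < S := Real.sqrt_pos.2 (mul_pos hQ hV)
  have hS2 : S ^ 2 = Q * V := Real.sq_sqrt (mul_pos hQ hV).le
  have hu0 := M.emitOp_nonneg hq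
  have hw0 := M.emitOp_nonneg hv0
  have hDx : ∀ x, M.emitOp D x ^ 2 ≤ M.emitOp q x * M.emitOp v x := fun x => by
    refine Finset.sum_sq_le_sum_mul_sum_of_sq_le_mul _
      (fun h _ => mul_nonneg (M.emit_nonneg h x) (hq h))
      (fun h _ => mul_nonneg (M.emit_nonneg h x) (hv0 h)) fun h _ => le_of_eq ?_
    by_cases hh : q h = 0
    · simp [hh, hDq h hh]
    · simp only [hv]
      field_simp
  by_cases hA : S / 2 ≤ ∑ h, |D h|
  · have h2 := sq_sum_sqrt_add_sq_sum_abs_le _ _ (M.emitOp D) hu0 hw0 hDx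
    rw [M.sum_emitOp, M.sum_emitOp, ← hQdef, ← hVdef, ← hS2] at h2
    have h3 : γ * ∑ h, |D h| ≤ ∑ x, |M.emitOp D x| := by
      have := hM.of_nonneg hp0 (fun h => mul_nonneg ht0 (hq h)) hsum
      simpa only [hD, emitOp_sub] using this
    have h4 : (γ * (S / 2)) ^ 2 ≤ (∑ x, |M.emitOp D x|) ^ 2 := by
      gcongr
      exact le_trans (by gcongr) h3
    -- The squared sum is at most `(1 - γ² / 4) S²`, more than enough here.
    refine abs_le_of_sq_le_sq' (b := (1 - γ ^ 2 / 32) * S) ?_ ?_ |>.2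
    · have h5 : 0 ≤ γ ^ 2 * S ^ 2 := by positivity
      nlinarith [sq_nonneg (γ ^ 2 * S)]
    · have : γ ^ 2 ≤ 1 := pow_le_one₀ hγ.le hγ1
      exact mul_nonneg (by linarith) hSpos.le
  · push Not at hA
    have hle : ∑ x, √(M.emitOp q x * M.emitOp v x - M.emitOp D x ^ 2)
        ≤ ∑ x, √(M.emitOp q x * M.emitOp v x) :=
      Finset.sum_le_sum fun x _ => Real.sqrt_le_sqrt (by linarith [sq_nonneg (M.emitOp D x)])
    have h1 := sum_sqrt_mul_le _ _ hu0 hw0 (by rw [M.sum_emitOp]; exact hQ)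
      (by rw [M.sum_emitOp]; exact hV)
    rw [M.sum_emitOp, M.sum_emitOp, ← hQdef, ← hVdef, ← hS] at h1
    have h2 := hM.of_nonneg (a := fun h => q h / Q) (b := fun h => v h / V)
      (fun h => div_nonneg (hq h) hQ.le) (fun h => div_nonneg (hv0 h) hV.le)
      (by rw [← Finset.sum_div, ← Finset.sum_div, div_self hQ.ne', div_self hV.ne'])
    simp only [emitOp_div] at h2
    -- `|D| / S` is the geometric mean of `q / Q` and `v / V`, so it dominates the smaller one; its
    -- sum is below `1 / 2`. With `h1` and `h2`, this case fixes the constant: `(γ / 2)² / 8 = γ² /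
    -- 32`.
    have h3 : 1 / 2 ≤ ∑ h, |q h / Q - v h / V| := by
      have hpt : ∀ h, q h / Q - |D h| / S ≤ |q h / Q - v h / V| := fun h => by
        rcases (hq h).eq_or_lt with hh | hh
        · simp [← hh, hv, hDq h hh.symm]
        · have hα : 0 < q h / Q := div_pos hh hQ
          have hy : 0 ≤ |D h| / S := by positivity
          have hvV : v h / V = (|D h| / S) ^ 2 / (q h / Q) := by
            rw [div_pow, hS2, sq_abs]
            simp only [hv]
            field_simp
          rw [hvV]
          rcases le_total (q h / Q) (|D h| / S) with hc | hc
          · exact le_trans (by linarith) (abs_nonneg _)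
          · refine le_trans ?_ (le_abs_self _)
            have : (|D h| / S) ^ 2 / (q h / Q) ≤ |D h| / S := by
              rw [div_le_iff₀ hα, sq]
              gcongr
            linarith
      have := Finset.sum_le_sum fun h (_ : h ∈ Finset.univ) => hpt h
      rw [Finset.sum_sub_distrib, ← Finset.sum_div, ← Finset.sum_div, div_self hQ.ne'] at this
      refine le_trans ?_ this
      have : (∑ h, |D h|) / S ≤ 1 / 2 := by
        rw [div_le_iff₀ hSpos]
        linarith
      linarith
    have h4 : (γ * (1 / 2)) ^ 2 ≤
        (∑ x, |M.emitOp q x / Q - M.emitOp v x / V|) ^ 2 := by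
      gcongr
      exact le_trans (by gcongr) h2
    refine hle.trans (h1.trans ?_)
    rw [mul_comm]
    exact mul_le_mul_of_nonneg_right (by linarith) hSpos.le

end HMM

/-! ### Barycentric spanners. -/

/-- A finite family of vectors contains a barycentric spanner: a subfamily, no longer than the
dimension of the space, in which all vectors have coordinates of absolute value at most `1`. -/
lemma exists_barycentric_spanner {ι E : Type*} [Finite ι] [AddCommGroup E] [Module ℝ E]
    [Module.Finite ℝ E] (v : ι → E) :
    ∃ n ≤ Module.finrank ℝ E, ∃ f : Fin n → ι,
      ∀ i, ∃ c : Fin n → ℝ, (∀ j, |c j| ≤ 1) ∧ v i = ∑ j, c j • v (f j) := by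
  classical
  let W := Submodule.span ℝ (Set.range v)
  refine ⟨Module.finrank ℝ W, Submodule.finrank_le _, ?_⟩
  let v' : ι → W := fun i => ⟨v i, Submodule.subset_span (Set.mem_range_self i)⟩
  obtain ⟨b, hb, -, hli⟩ := Submodule.exists_fun_fin_finrank_span_eq ℝ (Set.range v)
  choose f₀ hf₀ using hb
  have hli' : LinearIndependent ℝ (fun j => v' (f₀ j)) := by
    refine LinearIndependent.of_comp W.subtype ?_
    have : ⇑W.subtype ∘ (fun j => v' (f₀ j)) = b := funext hf₀
    rw [this]
    exact hli
  let e : Module.Basis (Fin (Module.finrank ℝ W)) ℝ W :=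
    basisOfLinearIndependentOfCardEqFinrank' (fun j => v' (f₀ j)) hli' (Fintype.card_fin _)
  have : Nonempty (Fin (Module.finrank ℝ W) → ι) := ⟨f₀⟩
  -- A subfamily of maximal determinant in the span works: by Cramer's rule a coordinate is the
  -- ratio of the determinant after swapping in `v i` to the maximal one.
  obtain ⟨f, hf⟩ := Finite.exists_max fun f : Fin (Module.finrank ℝ W) → ι =>
    |e.det fun j => v' (f j)|
  have h1 : 1 ≤ |e.det fun j => v' (f j)| := by
    refine le_trans (le_of_eq ?_) (hf f₀)
    have : e.det e = 1 := e.det_self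
    rw [show (fun j => v' (f₀ j)) = e from (coe_basisOfLinearIndependentOfCardEqFinrank' ..).symm, this, abs_one]
  have hdet : (e.det fun j => v' (f j)) ≠ 0 := fun h => by
    rw [h, abs_zero] at h1
    linarith
  obtain ⟨hl, hs⟩ := e.is_basis_iff_det.2 (isUnit_iff_ne_zero.2 hdet)
  refine ⟨f, fun i => ⟨fun j => (Module.Basis.mk hl hs.ge).coord j (v' i), fun j => ?_, ?_⟩⟩
  · have h := LinearMap.congr_fun (e.det_smul_mk_coord_eq_det_update hl hs.ge j) (v' i)
    rw [LinearMap.smul_apply, smul_eq_mul] at h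
    have h2 : |e.det.toMultilinearMap.toLinearMap (fun j => v' (f j)) j (v' i)|
        ≤ |e.det fun j => v' (f j)| := by
      refine le_trans (le_of_eq ?_) (hf (Function.update f j i))
      change |e.det (Function.update (fun j => v' (f j)) j (v' i))| = _
      refine congrArg (fun u => |e.det u|) (funext fun k => ?_)
      by_cases hk : k = j
      · subst hk; simp
      · simp [hk]
    rw [← h, abs_mul] at h2
    exact le_of_mul_le_mul_left (by linarith) (abs_pos.2 hdet)
  · have h := (Module.Basis.mk hl hs.ge).sum_repr (v' i)
    have h' := congrArg W.subtype h
    simpa [v'] using h'.symm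

/-! ### The filter, its forgetting, and the law of the observations. -/

namespace HMM

variable {H : Type u} {O : Type v} [Fintype H] [Fintype O]

/-- The law of the next hidden state, for a law (or a measure) `b` of the current one. -/
def pushTrans (M : HMM H O) (b : H → ℝ) (h' : H) : ℝ := ∑ h, M.trans h h' * b h

lemma pushTrans_nonneg (M : HMM H O) {b : H → ℝ} (hb : ∀ h, 0 ≤ b h) (h' : H) :
    0 ≤ M.pushTrans b h' :=
  Finset.sum_nonneg fun h _ => mul_nonneg (M.trans_nonneg h h') (hb h)

lemma sum_pushTrans (M : HMM H O) (b : H → ℝ) : ∑ h', M.pushTrans b h' = ∑ h, b h := by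
  unfold pushTrans
  rw [Finset.sum_comm]
  refine Finset.sum_congr rfl fun h _ => ?_
  rw [← Finset.sum_mul, (M.trans_mem h).2, one_mul]

lemma pushTrans_eq_zero (M : HMM H O) {p q : H → ℝ} (hq : ∀ h, 0 ≤ q h)
    (hp : ∀ h, q h = 0 → p h = 0) (h' : H) (h0 : M.pushTrans q h' = 0) : M.pushTrans p h' = 0 := by
  refine Finset.sum_eq_zero fun h _ => ?_
  have := (Finset.sum_eq_zero_iff_of_nonneg
    fun h _ => mul_nonneg (M.trans_nonneg h h') (hq h)).1 h0 h (Finset.mem_univ h)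
  rcases mul_eq_zero.1 this with h1 | h1
  · rw [h1, zero_mul]
  · rw [hp h h1, mul_zero]

/-- Data processing: masses are preserved, and Cauchy–Schwarz over the predecessors of each `h'`
bounds the quadratic term. -/
lemma chiMass_pushTrans_le (M : HMM H O) (p q : H → ℝ) (hq : ∀ h, 0 ≤ q h)
    (hp : ∀ h, q h = 0 → p h = 0) : chiMass (M.pushTrans p) (M.pushTrans q) ≤ chiMass p q := by
  unfold chiMass
  rw [sum_pushTrans, sum_pushTrans, ← M.sum_pushTrans fun h => p h ^ 2 / q h]
  have hQ : 0 ≤ ∑ h, q h := Finset.sum_nonneg fun h _ => hq h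
  gcongr with h' _
  refine div_le_of_le_mul₀ (M.pushTrans_nonneg hq h')
    (M.pushTrans_nonneg (fun h => div_nonneg (sq_nonneg _) (hq h)) h') ?_
  refine Finset.sum_sq_le_sum_mul_sum_of_sq_le_mul _
    (fun h _ => mul_nonneg (M.trans_nonneg h h') (div_nonneg (sq_nonneg _) (hq h)))
    (fun h _ => mul_nonneg (M.trans_nonneg h h') (hq h)) fun h _ => le_of_eq ?_
  by_cases hh : q h = 0
  · simp [hh, hp h hh]
  · field_simp

/-- The filter: for a measure `b` of the first hidden state, the measure of the hidden state after
the observations `o`, on the event that these occur. -/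
def run (M : HMM H O) (b : H → ℝ) : {m : ℕ} → (Fin m → O) → H → ℝ
  | 0, _ => b
  | m + 1, o => M.pushTrans (M.condObs (o (Fin.last m)) (M.run b fun i : Fin m => o i.castSucc))

lemma run_snoc (M : HMM H O) (b : H → ℝ) {m : ℕ} (o : Fin m → O) (x : O) :
    M.run b (Fin.snoc o x : Fin (m + 1) → O) = M.pushTrans (M.condObs x (M.run b o)) := by
  simp [run]

lemma run_add (M : HMM H O) (b : H → ℝ) {a : ℕ} : ∀ {n : ℕ} (o : Fin (a + n) → O),
    M.run b o = M.run (M.run b fun i => o (Fin.castAdd n i)) fun j => o (Fin.natAdd a j)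
  | 0, _ => rfl
  | n + 1, o => by
    have := M.run_add b (n := n) fun i : Fin (a + n) => o i.castSucc
    change M.pushTrans (M.condObs _ (M.run b fun i : Fin (a + n) => o i.castSucc)) = _
    rw [this]
    rfl

lemma run_nonneg (M : HMM H O) {b : H → ℝ} (hb : ∀ h, 0 ≤ b h) :
    ∀ {m : ℕ} (o : Fin m → O) (h : H), 0 ≤ M.run b o h
  | 0, _ => hb
  | _ + 1, _ => M.pushTrans_nonneg fun h => mul_nonneg (M.emit_nonneg h _) (M.run_nonneg hb _ h)

lemma run_eq_zero (M : HMM H O) {p q : H → ℝ} (hq : ∀ h, 0 ≤ q h)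
    (hp : ∀ h, q h = 0 → p h = 0) :
    ∀ {m : ℕ} (o : Fin m → O) (h : H), M.run q o h = 0 → M.run p o h = 0
  | 0, _ => hp
  | _ + 1, _ => M.pushTrans_eq_zero
      (fun h => mul_nonneg (M.emit_nonneg h _) (M.run_nonneg hq _ h)) fun h => by
        unfold condObs
        rw [mul_eq_zero, mul_eq_zero]
        exact Or.imp_right (M.run_eq_zero hq hp _ h)

lemma sum_pi_succ {m : ℕ} {α : Type*} [Fintype α] (F : (Fin (m + 1) → α) → ℝ) :
    ∑ o, F o = ∑ o : Fin m → α, ∑ x, F (Fin.snoc o x : Fin (m + 1) → α) := by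
  rw [← (Fin.snocEquiv fun _ => α).sum_comp, Fintype.sum_prod_type_right]
  rfl

lemma sum_run (M : HMM H O) (b : H → ℝ) : ∀ m : ℕ,
    ∑ o : Fin m → O, ∑ h, M.run b o h = ∑ h, b h
  | 0 => by simp [run]
  | m + 1 => by
    rw [sum_pi_succ, ← M.sum_run b m]
    refine Finset.sum_congr rfl fun o _ => ?_
    simp only [run_snoc, sum_pushTrans, sum_condObs, sum_emitOp]

/-- The filter forgets its initial law: the expected `χ`-divergence decays exponentially. -/
lemma sum_chiMass_run_le (M : HMM H O) {γ : ℝ} (hγ : 0 < γ) (hγ1 : γ ≤ 1)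
    (hM : M.IsObservable γ) (p q : H → ℝ) (hp0 : ∀ h, 0 ≤ p h) (hq : ∀ h, 0 ≤ q h)
    (hp : ∀ h, q h = 0 → p h = 0) : ∀ m : ℕ,
    ∑ o : Fin m → O, chiMass (M.run p o) (M.run q o) ≤ (1 - γ ^ 2 / 32) ^ m * chiMass p q
  | 0 => by simp [run]
  | m + 1 => by
    have hγ2 : γ ^ 2 ≤ 1 := pow_le_one₀ hγ.le hγ1
    rw [sum_pi_succ, pow_succ', mul_assoc]
    refine le_trans ?_ (mul_le_mul_of_nonneg_left
      (M.sum_chiMass_run_le hγ hγ1 hM p q hp0 hq hp m) (by linarith))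
    rw [Finset.mul_sum]
    refine Finset.sum_le_sum fun o _ => ?_
    simp only [run_snoc]
    refine le_trans (Finset.sum_le_sum fun x _ => M.chiMass_pushTrans_le _ _
      (fun h => mul_nonneg (M.emit_nonneg h _) (M.run_nonneg hq _ h)) fun h => ?_)
      (M.sum_chiMass_condObs_le hγ hγ1 hM _ _ (M.run_nonneg hp0 o) (M.run_nonneg hq o)
        (M.run_eq_zero hq hp o))
    unfold condObs
    rw [mul_eq_zero, mul_eq_zero]
    exact Or.imp_right (M.run_eq_zero hq hp _ h)

/-- This identifies the sum over hidden paths with the recursive filter. The test function `g` makes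
the induction close: it absorbs the last transition and emission. -/
lemma sum_jointProb_mul (M : HMM H O) : ∀ {n : ℕ} (o : Fin (n + 1) → O) (g : H → ℝ),
    ∑ h : Fin (n + 1) → H, M.jointProb h o * g (h (Fin.last n)) =
      ∑ h, M.condObs (o (Fin.last n)) (M.run M.init fun i : Fin n => o i.castSucc) h * g h
  | 0, o, g => by
    rw [← (Equiv.funUnique (Fin 1) H).symm.sum_comp]
    refine Finset.sum_congr rfl fun h _ => ?_
    simp [jointProb, condObs, run, uniqueElim_const, mul_comm (M.init h)]
  | n + 1, o, g => by
    have ih := M.sum_jointProb_mul (fun i : Fin (n + 1) => o i.castSucc)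
      fun h => ∑ y, M.trans h y * M.emit y (o (Fin.last _)) * g y
    rw [sum_pi_succ]
    refine Eq.trans ?_ (ih.trans ?_)
    · refine Finset.sum_congr rfl fun h _ => ?_
      rw [Finset.mul_sum]
      refine Finset.sum_congr rfl fun y _ => ?_
      have h0 : (Fin.snoc h y : Fin (n + 2) → H) 0 = h 0 := by
        rw [← Fin.castSucc_zero, Fin.snoc_castSucc]
      unfold jointProb
      rw [Fin.prod_univ_castSucc (n := n), Fin.prod_univ_castSucc (n := n + 1), h0]
      simp only [Fin.snoc_castSucc, Fin.snoc_last, Fin.succ_last, ← Fin.castSucc_succ]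
      ring
    · simp only [run, Finset.mul_sum]
      rw [Finset.sum_comm]
      refine Finset.sum_congr rfl fun y _ => ?_
      rw [condObs, pushTrans, Finset.mul_sum, Finset.sum_mul]
      refine Finset.sum_congr rfl fun h _ => ?_
      ring

lemma obsProb_succ (M : HMM H O) {n : ℕ} (o : Fin (n + 1) → O) :
    M.obsProb o = M.emitOp (M.run M.init fun i : Fin n => o i.castSucc) (o (Fin.last n)) := by
  have := M.sum_jointProb_mul o fun _ => 1
  simp only [mul_one] at this
  exact this

lemma obsProb_eq_sum_run (M : HMM H O) : ∀ {m : ℕ} (o : Fin m → O),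
    M.obsProb o = ∑ h, M.run M.init o h
  | 0, _ => M.init_mem.2.symm
  | _ + 1, o => by
    rw [obsProb_succ, run, sum_pushTrans, sum_condObs]

lemma obsProb_snoc (M : HMM H O) {m : ℕ} (o : Fin m → O) (x : O) :
    M.obsProb (Fin.snoc o x : Fin (m + 1) → O) = M.emitOp (M.run M.init o) x := by
  rw [obsProb_succ]
  simp

/-! ### Consequences of low rank. -/

/-- Under a low rank transition, some law of the hidden state has a successor law that dominates
all transition probabilities up to the factor `d`. -/
lemma IsLowRank.exists_dominating {M : HMM H O} {d : ℕ} {w ψ : H → Fin d → ℝ}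
    (hM : M.IsLowRank w ψ) :
    ∃ ρ ∈ stdSimplex ℝ H, ∀ h h', M.trans h h' ≤ d * M.pushTrans ρ h' := by
  classical
  obtain ⟨n, hnd, f, hf⟩ := exists_barycentric_spanner ψ
  rw [Module.finrank_fin_fun] at hnd
  have hle : ∀ h h', M.trans h h' ≤ ∑ j, M.trans (f j) h' := fun h h' => by
    obtain ⟨c, hc, hψ⟩ := hf h
    have : M.trans h h' = ∑ j, c j * M.trans (f j) h' := by
      simp only [hM h, hM (f _), hψ, dotProduct_sum, dotProduct_smul, smul_eq_mul]
    rw [this]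
    exact Finset.sum_le_sum fun j _ => mul_le_of_le_one_left (M.trans_nonneg _ _)
      ((le_abs_self _).trans (hc j))
  have hn0 : n ≠ 0 := fun h0 => by
    have hz : ∀ h h', M.trans h h' = 0 := fun h h' => by
      refine le_antisymm ((hle h h').trans (le_of_eq ?_)) (M.trans_nonneg _ _)
      have : IsEmpty (Fin n) := by rw [h0]; infer_instance
      simp
    obtain ⟨h, -⟩ : ∃ h, M.init h ≠ 0 := by
      by_contra! hi
      simpa [hi] using M.init_mem.2
    simpa [hz] using (M.trans_mem h).2
  have hnpos : (0 : ℝ) < n := by exact_mod_cast Nat.pos_of_ne_zero hn0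
  -- `ρ` is uniform on the spanner states, with multiplicity; the factor `n` lost in averaging is at
  -- most `d`.
  refine ⟨fun h => (∑ j, if f j = h then 1 else 0) / n, ⟨fun h => ?_, ?_⟩, fun h h' => ?_⟩
  · exact div_nonneg (Finset.sum_nonneg fun j _ => by split_ifs <;> norm_num) hnpos.le
  · rw [← Finset.sum_div, Finset.sum_comm]
    simp [hnpos.ne']
  · have hb : M.pushTrans (fun h => (∑ j, if f j = h then 1 else 0) / (n : ℝ)) h'
        = (∑ j, M.trans (f j) h') / n := by
      unfold pushTrans
      simp only [← mul_div_assoc, Finset.mul_sum]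
      rw [← Finset.sum_div, Finset.sum_comm]
      simp
    rw [hb]
    refine (hle h h').trans ?_
    rw [← mul_div_assoc, le_div_iff₀ hnpos, mul_comm]
    exact mul_le_mul_of_nonneg_right (by exact_mod_cast hnd)
      (Finset.sum_nonneg fun j _ => M.trans_nonneg _ _)

lemma IsLowRank.pushTrans_eq {M : HMM H O} {d : ℕ} {w ψ : H → Fin d → ℝ}
    (hM : M.IsLowRank w ψ) (b : H → ℝ) (h' : H) :
    M.pushTrans b h' = w h' ⬝ᵥ ∑ h, b h • ψ h := by
  simp only [pushTrans, hM _ h', dotProduct_sum, dotProduct_smul, smul_eq_mul, mul_comm]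

lemma obsFeature_dotProduct (M : HMM H O) {d : ℕ} (w : H → Fin d → ℝ) (φ : Fin d → ℝ) (x : O) :
    M.obsFeature w x ⬝ᵥ φ = M.emitOp (fun h => w h ⬝ᵥ φ) x := by
  simp only [obsFeature, emitOp, sum_dotProduct, smul_dotProduct, smul_eq_mul]

/-- The filter, normalized; histories of probability `0` leave the initial law `b`. -/
noncomputable def posterior (M : HMM H O) (b : H → ℝ) {m : ℕ} (o : Fin m → O) : H → ℝ :=
  if ∑ h, M.run b o h = 0 then b else fun h => M.run b o h / ∑ h', M.run b o h'

lemma posterior_mem (M : HMM H O) {b : H → ℝ} (hb : b ∈ stdSimplex ℝ H) {m : ℕ} (o : Fin m → O) :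
    M.posterior b o ∈ stdSimplex ℝ H := by
  unfold posterior
  split_ifs with h
  · exact hb
  · exact ⟨fun h' => div_nonneg (M.run_nonneg hb.1 o h')
      (Finset.sum_nonneg fun h' _ => M.run_nonneg hb.1 o h'), by rw [← Finset.sum_div, div_self h]⟩

lemma IsLowRank.exists_posterior_eq {M : HMM H O} {d : ℕ} {w ψ : H → Fin d → ℝ}
    (hM : M.IsLowRank w ψ) (ρ : H → ℝ) {m : ℕ} (o : Fin m → O) :
    ∃ φ : Fin d → ℝ, ∀ h, M.posterior (M.pushTrans ρ) o h = w h ⬝ᵥ φ := by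
  unfold posterior
  split_ifs
  -- The default value on null histories must also be linear in `w`; it is, being an image under the
  -- transition.
  · exact ⟨_, hM.pushTrans_eq ρ⟩
  · obtain ⟨φ, hφ⟩ : ∃ φ : Fin d → ℝ, ∀ h, M.run (M.pushTrans ρ) o h = w h ⬝ᵥ φ := by
      cases m with
      | zero => exact ⟨_, hM.pushTrans_eq ρ⟩
      | succ m => exact ⟨_, hM.pushTrans_eq _⟩
    refine ⟨(∑ h, M.run (M.pushTrans ρ) o h)⁻¹ • φ, fun h => ?_⟩
    rw [dotProduct_smul, ← hφ, smul_eq_mul]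
    exact div_eq_inv_mul _ _

/-! ### Prediction error and memory length. -/

/-- The error of the prediction from the most recent observations, started from `b`. -/
lemma obsProb_mul_sum_abs_le (M : HMM H O) {b : H → ℝ} (hb : b ∈ stdSimplex ℝ H) {m n : ℕ}
    (o : Fin m → O) (z : Fin n → O) (p : H → ℝ) (hpb : ∀ h, b h = 0 → p h = 0)
    (ho : M.run M.init o = M.run p z) :
    M.obsProb o * ∑ x, |M.condProb o x - M.emitOp (M.posterior b z) x|
      ≤ chiMass (M.run p z) (M.run b z) := by
  by_cases hP : M.obsProb o = 0
  · rw [hP, zero_mul]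
    exact chiMass_nonneg _ _
  have hP0 : 0 ≤ M.obsProb o := by
    rw [obsProb_eq_sum_run]
    exact Finset.sum_nonneg fun h _ => M.run_nonneg M.init_mem.1 _ h
  have hac := M.run_eq_zero hb.1 hpb z
  have hq := M.run_nonneg hb.1 z
  have hsum : M.obsProb o = ∑ h, M.run p z h := by rw [obsProb_eq_sum_run, ho]
  have hQ : ∑ h, M.run b z h ≠ 0 := fun h0 => hP <| by
    rw [hsum]
    exact Finset.sum_eq_zero fun h _ => hac h
      ((Finset.sum_eq_zero_iff_of_nonneg fun i _ => hq i).1 h0 h (Finset.mem_univ h))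
  refine le_trans (le_of_eq ?_) ((M.sum_abs_emitOp_le _).trans
    (sum_abs_le_chiMass (M.run p z) (M.run b z) hq hac))
  rw [Finset.mul_sum]
  refine Finset.sum_congr rfl fun x _ => ?_
  rw [emitOp_sub, condProb, obsProb_snoc, ho, posterior, if_neg hQ, emitOp_div, ← hsum]
  rw [← abs_of_nonneg hP0, ← abs_mul, abs_of_nonneg hP0]
  congr 1
  have : M.emitOp (fun h => M.obsProb o / (∑ h, M.run b z h) * M.run b z h) x
      = M.obsProb o / (∑ h, M.run b z h) * M.emitOp (M.run b z) x := by
    unfold emitOp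
    rw [Finset.mul_sum]
    exact Finset.sum_congr rfl fun h _ => by ring
  rw [this]
  field_simp

lemma expectedError_posterior_le (M : HMM H O) {b : H → ℝ} (hb : b ∈ stdSimplex ℝ H) {l a : ℕ}
    (hk : l + 1 < a + (l + 1)) (hac : ∀ (o : Fin a → O) h, b h = 0 → M.run M.init o h = 0) :
    M.expectedError hk (fun z => M.emitOp (M.posterior b z)) ≤
      ∑ o : Fin a → O, ∑ z : Fin l → O, chiMass (M.run (M.run M.init o) z) (M.run b z) := by
  unfold expectedError
  change ∑ o : Fin (a + l) → O, _ ≤ _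
  rw [← (Fin.appendEquiv a l).sum_comp, Fintype.sum_prod_type]
  refine Finset.sum_le_sum fun o _ => Finset.sum_le_sum fun z _ => ?_
  have hz : recentObs hk (Fin.append o z) = z := by
    funext i
    have : (⟨a + (l + 1) - (l + 1) + i, by have := i.2; omega⟩ : Fin (a + l)) = Fin.natAdd a i := by
      ext
      simp
    change Fin.append o z ⟨a + (l + 1) - (l + 1) + i, _⟩ = z i
    rw [this, Fin.append_right]
  have h := M.obsProb_mul_sum_abs_le hb (Fin.append o z) z (M.run M.init o) (hac o)
    (by rw [run_add]; simp)
  refine le_trans (le_of_eq ?_) h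
  change M.obsProb (Fin.append o z) * ∑ x, |M.condProb (Fin.append o z) x
    - M.emitOp (M.posterior b (recentObs hk (Fin.append o z))) x| = _
  rw [hz]

/-- A density bounded by `d` has second moment at most `d`, so `χ² ≤ d - 1`. -/
lemma chiMass_le_of_le {p q : H → ℝ} (hp : ∀ h, 0 ≤ p h) (hq : ∀ h, 0 ≤ q h)
    (hq1 : ∑ h, q h = 1) {d : ℝ} (hd : ∀ h, p h ≤ d * (∑ h, p h) * q h) :
    chiMass p q ≤ √(d - 1) * ∑ h, p h := by
  set P := ∑ h, p h with hP
  have hP0 : 0 ≤ P := Finset.sum_nonneg fun h _ => hp h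
  have h : ∑ h, p h ^ 2 / q h ≤ d * P * P := by
    conv_rhs => rw [hP, Finset.mul_sum]
    refine Finset.sum_le_sum fun h _ => ?_
    rcases (hq h).eq_or_lt with h0 | h0
    · have : p h = 0 := le_antisymm (by simpa [← h0] using hd h) (hp h)
      simp [this]
    · rw [div_le_iff₀ h0, sq]
      calc p h * p h ≤ p h * (d * P * q h) := mul_le_mul_of_nonneg_left (hd h) (hp h)
        _ = _ := by ring
  calc chiMass p q ≤ √((d - 1) * P ^ 2) := by
        unfold chiMass
        rw [hq1]
        exact Real.sqrt_le_sqrt (by rw [← hP]; linarith)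
    _ = √(d - 1) * P := by rw [Real.sqrt_mul' _ (sq_nonneg _), Real.sqrt_sq hP0]

lemma run_succ_le (M : HMM H O) {b p : H → ℝ} {d : ℝ} (hp : ∀ h, 0 ≤ p h)
    (hb : ∀ h h', M.trans h h' ≤ d * b h') {m : ℕ} (o : Fin (m + 1) → O) (h' : H) :
    M.run p o h' ≤ d * (∑ h, M.run p o h) * b h' := by
  rw [run, sum_pushTrans, pushTrans, mul_right_comm, Finset.mul_sum]
  exact Finset.sum_le_sum fun h _ => mul_le_mul_of_nonneg_right (hb h h')
    (mul_nonneg (M.emit_nonneg _ _) (M.run_nonneg hp _ h))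

/-- Emission does not expand `L¹` distances, so `γ > 1` forces all laws of the hidden state to
coincide. -/
lemma IsObservable.chiMass_eq_zero {M : HMM H O} {γ : ℝ} (hM : M.IsObservable γ) (hγ : 1 < γ)
    {p q : H → ℝ} (hp : ∀ h, 0 ≤ p h) (hq : ∀ h, 0 ≤ q h) (hq1 : ∑ h, q h = 1) :
    chiMass p q = 0 := by
  set P := ∑ h, p h with hP
  have hP0 : 0 ≤ P := Finset.sum_nonneg fun h _ => hp h
  have h1 := hM.of_nonneg hp (fun h => mul_nonneg hP0 (hq h))
    (by rw [← Finset.mul_sum, hq1, mul_one])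
  have h2 := M.sum_abs_emitOp_le fun h => p h - P * q h
  simp only [emitOp_sub] at h2
  have h0 : 0 ≤ ∑ h, |p h - P * q h| := Finset.sum_nonneg fun h _ => abs_nonneg _
  have h3 : ∑ h, |p h - P * q h| = 0 := by nlinarith
  have h4 : ∀ h, p h = P * q h := fun h => sub_eq_zero.1 <| abs_eq_zero.1 <|
    (Finset.sum_eq_zero_iff_of_nonneg fun i _ => abs_nonneg _).1 h3 h (Finset.mem_univ h)
  rw [← chiMass_sub_smul p q (fun h hh => by rw [h4, hh, mul_zero]) P]
  simp [chiMass, ← h4]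

lemma pow_mul_sqrt_le {γ ε : ℝ} {d l : ℕ} (hd : 0 < d) (hγ : 0 < γ) (hγ1 : γ ≤ 1) (hε : 0 < ε)
    (hL : 32 * (γ ^ 4)⁻¹ * Real.log (d / ε) ≤ (l + 1 : ℕ)) :
    (1 - γ ^ 2 / 32) ^ l * √((d : ℝ) - 1) ≤ ε := by
  have hd0 : (0 : ℝ) < d := by exact_mod_cast hd
  have hd1 : (1 : ℝ) ≤ d := by exact_mod_cast hd
  have hγ2 : γ ^ 2 ≤ 1 := pow_le_one₀ hγ.le hγ1
  have h4 : 0 < γ ^ 4 := by positivity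
  push_cast at hL
  have h1 : Real.log (d / ε) ≤ (l + 1) * γ ^ 2 / 32 := by
    have : 32 * Real.log (d / ε) ≤ (l + 1) * γ ^ 4 := by
      rw [mul_right_comm, ← div_eq_mul_inv, div_le_iff₀ h4] at hL
      exact hL
    -- Only `γ²` is needed below; `γ⁴` leaves slack.
    have : ((l : ℝ) + 1) * γ ^ 4 ≤ (l + 1) * γ ^ 2 :=
      mul_le_mul_of_nonneg_left (pow_le_pow_of_le_one hγ.le hγ1 (by norm_num)) (by positivity)
    linarith
  have h2 : d * Real.exp (-((l + 1) * γ ^ 2 / 32)) ≤ ε := by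
    rw [Real.log_le_iff_le_exp (by positivity), div_le_iff₀ hε] at h1
    rw [Real.exp_neg, ← div_eq_mul_inv, div_le_iff₀ (Real.exp_pos _)]
    linarith
  refine le_trans ?_ h2
  have h3 : (1 - γ ^ 2 / 32) ^ l ≤ Real.exp (-(l * (γ ^ 2 / 32))) := by
    have : 1 - γ ^ 2 / 32 ≤ Real.exp (-(γ ^ 2 / 32)) := Real.one_sub_le_exp_neg _
    rw [← mul_neg, Real.exp_nat_mul]
    exact pow_le_pow_left₀ (by linarith) this l
  -- The exponent is `l = L - 1`, one short of `L`; the factor `1 / 2` gained here pays for the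
  -- missing one through `h6`.
  have h5 : √((d : ℝ) - 1) ≤ d / 2 :=
    Real.sqrt_le_iff.2 ⟨by positivity, by nlinarith [sq_nonneg ((d : ℝ) - 2)]⟩
  have h6 : (1 : ℝ) / 2 ≤ Real.exp (-(γ ^ 2 / 32)) := by
    have := Real.one_sub_le_exp_neg (γ ^ 2 / 32)
    linarith
  calc (1 - γ ^ 2 / 32) ^ l * √((d : ℝ) - 1)
      ≤ Real.exp (-(l * (γ ^ 2 / 32))) * (d / 2) := by gcongr
    _ ≤ Real.exp (-(l * (γ ^ 2 / 32))) * (d * Real.exp (-(γ ^ 2 / 32))) := by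
        gcongr
        linarith [mul_le_mul_of_nonneg_left h6 hd0.le]
    _ = d * Real.exp (-((l + 1) * γ ^ 2 / 32)) := by
        rw [mul_left_comm, ← Real.exp_add]
        congr 2
        ring

end HMM

theorem mainTheorem3 :
    ∃ C : ℝ, 0 < C ∧
      ∀ (H : Type u) (O : Type v) [Fintype H] [Fintype O] (M : HMM H O)
        (d : ℕ) (w ψ : H → Fin d → ℝ) (γ ε : ℝ),
        M.IsLowRank w ψ → 0 < γ → M.IsObservable γ → 0 < ε →
        ∀ L : ℕ, 1 ≤ L → C * (γ ^ 4)⁻¹ * Real.log (d / ε) ≤ L →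
          ∃ (P_L : (Fin (L - 1) → O) → O → ℝ) (φ : (Fin (L - 1) → O) → Fin d → ℝ),
            (∀ z, P_L z ∈ stdSimplex ℝ O) ∧
            (∀ z x, P_L z x = M.obsFeature w x ⬝ᵥ φ z) ∧
            ∀ (k : ℕ) (hk : L < k), M.expectedError hk P_L ≤ ε := by
  refine ⟨32, by norm_num, ?_⟩
  intro H O _ _ M d w ψ γ ε hLR hγ hM hε L hL1 hL
  obtain ⟨l, rfl⟩ : ∃ l, L = l + 1 := ⟨L - 1, by omega⟩
  obtain ⟨ρ, hρ, hdom⟩ := hLR.exists_dominating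
  set b := M.pushTrans ρ with hbdef
  have hb : b ∈ stdSimplex ℝ H :=
    ⟨M.pushTrans_nonneg hρ.1, by rw [hbdef, M.sum_pushTrans]; exact hρ.2⟩
  have hd : 0 < d := by
    rcases Nat.eq_zero_or_pos d with rfl | h
    · have h1 : b = 0 := by
        funext h
        rw [hbdef, hLR.pushTrans_eq]
        simp
      simpa [h1] using hb.2
    · exact h
  choose φ hφ using fun z : Fin l → O => hLR.exists_posterior_eq ρ z
  refine ⟨fun z => M.emitOp (M.posterior b z), φ, fun z => ?_, fun z x => ?_, fun k hk => ?_⟩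
  · have hz := M.posterior_mem hb z
    exact ⟨M.emitOp_nonneg hz.1, by rw [M.sum_emitOp]; exact hz.2⟩
  · rw [M.obsFeature_dotProduct]
    exact congrArg (fun c => M.emitOp c x) (funext (hφ z))
  -- At least one observation, hence one transition, precedes the window, so `b` dominates the law
  -- at its start.
  · obtain ⟨a, rfl⟩ : ∃ a, k = a + 1 + (l + 1) := ⟨k - (l + 2), by omega⟩
    have hrun := M.run_nonneg M.init_mem.1 (m := a + 1)
    have hdomr := fun o : Fin (a + 1) → O => M.run_succ_le M.init_mem.1 hdom o
    have hac : ∀ (o : Fin (a + 1) → O) h, b h = 0 → M.run M.init o h = 0 := fun o h h0 =>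
      le_antisymm ((hdomr o h).trans_eq (by rw [h0, mul_zero])) (hrun o h)
    refine (M.expectedError_posterior_le hb hk hac).trans ?_
    rcases le_or_gt γ 1 with hγ1 | hγ1
    · have hγ2 : γ ^ 2 ≤ 1 := pow_le_one₀ hγ.le hγ1
      calc _ ≤ ∑ o : Fin (a + 1) → O, (1 - γ ^ 2 / 32) ^ l *
            (√((d : ℝ) - 1) * ∑ h, M.run M.init o h) := Finset.sum_le_sum fun o _ =>
              (M.sum_chiMass_run_le hγ hγ1 hM _ _ (hrun o) hb.1 (hac o) l).trans
                (mul_le_mul_of_nonneg_left (HMM.chiMass_le_of_le (hrun o) hb.1 hb.2 (hdomr o))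
                  (pow_nonneg (by linarith) l))
        _ = (1 - γ ^ 2 / 32) ^ l * √((d : ℝ) - 1) := by
            rw [← Finset.mul_sum, ← Finset.mul_sum, M.sum_run, M.init_mem.2, mul_one]
        _ ≤ ε := HMM.pow_mul_sqrt_le hd hγ hγ1 hε hL
    -- The contraction estimate needs `γ ≤ 1`; it is applied with constant `1` to an initial
    -- divergence that is already zero.
    · have hM1 : M.IsObservable 1 := fun c hc c' hc' =>
        (mul_le_mul_of_nonneg_right hγ1.le
          (Finset.sum_nonneg fun h _ => abs_nonneg _)).trans (hM c hc c' hc')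
      refine (Finset.sum_nonpos fun o _ => ?_).trans hε.le
      have := M.sum_chiMass_run_le one_pos le_rfl hM1 _ _ (hrun o) hb.1 (hac o) l
      rwa [hM.chiMass_eq_zero hγ1 (hrun o) hb.1 hb.2, mul_zero] at this
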